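/- Fix $\lambda>0$. For $\alpha>0$ let $X_1,X_2,X_3$ be a random sample of size $n=3$ from the gamma distribution with density $\frac{1}{\Gamma(\alpha)\lambda^{\alpha}}x^{\alpha-1}e^{-x/\lambda}$, $x>0$. Let $\bar X=\frac13\sum_i X_i$, $S^2=\frac13\sum_i (X_i-\bar X)^2$, $\hat\alpha=\bar X^2/S^2$ (the moment estimator of $\alpha$) and $T=\bar X/S=\sqrt{\hat\alpha}$. For nonnegative random variables with continuous distribution functions $F$ and $G$, the first is smaller than the second in the star order $\le_*$ if $G^{-1}(F(x))/x$ is nondecreasing in $x>0$ (over those $x$ with $0<F(x)<1$), where $G^{-1}(u)=\inf\{y: u\le G(y)\}$. Then for $n=3$ the estimator $\hat\alpha$ is not increasing in $\alpha$ with respect to the star order: it is not true that, for all $0<\alpha_1<\alpha_2$, the estimator based on a sample with shape $\alpha_1$ is smaller in the order $\le_*$ than the estimator based on a sample with shape $\alpha_2$. Moreover, if $F$ and $G$ denote the distribution functions of $T$ for $\alpha=1$ and $\alpha=2$ respectively, then $G^{-1}(F(x))/x$ equals $1.32686$ at $x=\frac{11}{10}$, $1.31502$ at $x=\frac{\sqrt6}{2}$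 and $1.32081$ at $x=\sqrt2$, each with an error of at most $5\cdot10^{-6}$; in particular this function is not monotone. -/

import Mathlib

open MeasureTheory ProbabilityTheory

noncomputable section

/-- Sample mean of `x₁, …, xₙ`. -/
def sampleMean {n : ℕ} (x : Fin n → ℝ) : ℝ :=
  (∑ i, x i) / n

/-- Biased sample variance `(1/n) ∑ (xᵢ - x̄)²` of `x₁, …, xₙ`. -/
def sampleVar {n : ℕ} (x : Fin n → ℝ) : ℝ :=
  (∑ i, (x i - sampleMean x) ^ 2) / n

/-- The moment estimator `x̄² / s²` of the shape parameter of the gamma distribution. -/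
def alphaHat {n : ℕ} (x : Fin n → ℝ) : ℝ :=
  sampleMean x ^ 2 / sampleVar x

/-- The ratio `x̄ / s`, with `s` the biased sample standard deviation. -/
def meanStdRatio {n : ℕ} (x : Fin n → ℝ) : ℝ :=
  sampleMean x / Real.sqrt (sampleVar x)

/-- The law of a statistic `stat` of a random sample of size `n` (independent observations) from
the gamma distribution with shape `α` and scale `lam`, that is, with density
`x ^ (α - 1) * exp (-x / lam) / (Γ(α) * lam ^ α)` on `x > 0`.
Mathlib's `gammaMeasure` is parametrized by the rate, which is the inverse of the scale. -/
def gammaSampleLaw (n : ℕ) (stat : (Fin n → ℝ) → ℝ) (α lam : ℝ) : Measure ℝ :=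
  (Measure.pi fun _ : Fin n => gammaMeasure α lam⁻¹).map stat

/-- The generalized inverse `G⁻¹(u) = inf {y | u ≤ G(y)}` of the distribution function `G` of `ν`
(meaningful for `0 < u < 1`). -/
def quantile (ν : Measure ℝ) (u : ℝ) : ℝ :=
  sInf {y : ℝ | u ≤ cdf ν y}

/-- The function `x ↦ G⁻¹(F(x)) / x`, with `F` and `G` the distribution functions of `μ`, `ν`. -/
def starRatio (μ ν : Measure ℝ) (x : ℝ) : ℝ :=
  quantile ν (cdf μ x) / x

/-- The star order `μ ≤_* ν` between the laws of two nonnegative random variables with continuous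
distribution functions `F`, `G`: the function `G⁻¹(F(x)) / x` is nondecreasing in `x > 0`.
Here `x` ranges over the points where `0 < F(x) < 1`, since `G⁻¹(0)` and `G⁻¹(1)` are matters of
convention. -/
def StarOrder (μ ν : Measure ℝ) : Prop :=
  MonotoneOn (starRatio μ ν) {x : ℝ | 0 < x ∧ 0 < cdf μ x ∧ cdf μ x < 1}

/-- An estimator of a positive parameter `θ`, whose law under `θ` is `law θ`, is increasing in `θ`
with respect to the order `prec`. -/
def IncreasingInParameter (prec : Measure ℝ → Measure ℝ → Prop) (law : ℝ → Measure ℝ) : Prop :=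
  ∀ θ₁ θ₂ : ℝ, 0 < θ₁ → θ₁ < θ₂ → prec (law θ₁) (law θ₂)

end

/-! Both statistics are invariant under scaling, so their laws depend only on the sample divided by
its sum, which has a symmetric Dirichlet law on the simplex. In suitable coordinates `p` on the
plane of sum 1 the mean is 1/3 and the variance is `2|p|²`, so `T > t` means that `p` lies in the
disc of squared radius `1/(18 t²)`. The simplex becomes an equilateral triangle with inradius 1/6
and circumradius 1/3.

For `α = 1` the law is uniform on the triangle. A disc of radius between 1/6 and 1/3 overhangs the
three sides in disjoint circular segments, so its probability is elementary (`discTail_one`). For `α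
= 2` the density is proportional to the product of the coordinates, a radial polynomial plus an odd
cubic; on a disc inside the triangle the odd part integrates to zero and the probability is a
polynomial in the squared radius (`discTail_two`).

The value of `G⁻¹(F(x))/x` is then located by comparing the two tails at `x` and at `(c ± ε) x`.
Since `α̂ = T²`, its ratio at `x²` is the square of that of `T` at `x`, so the drop between `x =
11/10` and `x = √6/2` refutes the star order for `α̂`. -/

open scoped ENNReal

/-! ### Reduction of a gamma sample to a Dirichlet law on the simplex -/

theorem lintegral_pi_prod_apply {n : ℕ} (f : Fin n → ℝ → ℝ≥0∞) (hf : ∀ i, Measurable (f i)) :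
    ∫⁻ x : Fin n → ℝ, ∏ i, f i (x i) = ∏ i, ∫⁻ t, f i t := by
  induction n with
  | zero => simp [lintegral_const, volume_pi]
  | succ n ih =>
    rw [← (volume_preserving_piFinSuccAbove (fun _ : Fin (n + 1) => ℝ) 0).symm.lintegral_comp_emb
      (MeasurableEquiv.measurableEmbedding _)]
    have h : ∀ z : ℝ × (Fin n → ℝ),
        ∏ i, f i ((MeasurableEquiv.piFinSuccAbove (fun _ : Fin (n + 1) => ℝ) 0).symm z i) =
          f 0 z.1 * ∏ i : Fin n, f i.succ (z.2 i) := fun z => by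
      rw [Fin.prod_univ_succ]
      rfl
    simp_rw [h]
    rw [Measure.volume_eq_prod, lintegral_prod_mul (f := f 0)
      (g := fun x : Fin n → ℝ => ∏ i : Fin n, f i.succ (x i)) (hf 0).aemeasurable
      (Finset.measurable_prod _ fun i _ =>
        (hf i.succ).comp (measurable_pi_apply i)).aemeasurable,
      ih _ fun i => hf i.succ, Fin.prod_univ_succ]

theorem pi_withDensity_volume {n : ℕ} (f : Fin n → ℝ → ℝ≥0∞) (hf : ∀ i, Measurable (f i))
    [∀ i, SigmaFinite ((volume : Measure ℝ).withDensity (f i))] :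
    Measure.pi (fun i => (volume : Measure ℝ).withDensity (f i)) =
      (volume : Measure (Fin n → ℝ)).withDensity fun x => ∏ i, f i (x i) := by
  refine (Measure.pi_eq fun s hs => ?_)
  rw [withDensity_apply _ (MeasurableSet.univ_pi hs),
    ← lintegral_indicator (MeasurableSet.univ_pi hs)]
  have h : ∀ x : Fin n → ℝ, (Set.univ.pi s).indicator (fun x => ∏ i, f i (x i)) x =
      ∏ i, (s i).indicator (f i) (x i) := by
    intro x
    by_cases hx : x ∈ Set.univ.pi s
    · rw [Set.indicator_of_mem hx]
      exact Finset.prod_congr rfl fun i _ => (Set.indicator_of_mem (hx i trivial) _).symm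
    · rw [Set.indicator_of_notMem hx]
      obtain ⟨i, hi⟩ : ∃ i, x i ∉ s i := by simpa [Set.mem_pi] using hx
      exact (Finset.prod_eq_zero (Finset.mem_univ i) (Set.indicator_of_notMem hi _)).symm
  simp_rw [h]
  rw [lintegral_pi_prod_apply _ fun i => (hf i).indicator (hs i)]
  refine Finset.prod_congr rfl fun i _ => ?_
  rw [lintegral_indicator (hs i), withDensity_apply _ (hs i)]

/-- A linear parametrization of the plane `x₀ + x₁ + x₂ = s` by `p`, with `p = 0` sent to the
diagonal point and `|x - x̄|² = 6 |p|²`. -/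
noncomputable def planePoint (s : ℝ) (p : ℝ × ℝ) : Fin 3 → ℝ :=
  ![s / 3 + p.1 + √3 * p.2, s / 3 + p.1 - √3 * p.2, s / 3 - 2 * p.1]

theorem measurable_planePoint (s : ℝ) : Measurable (planePoint s) := by
  refine measurable_pi_lambda _ fun i => ?_
  fin_cases i <;> simp only [planePoint] <;> simp <;> fun_prop

theorem smul_planePoint (s : ℝ) (p : ℝ × ℝ) : s • planePoint 1 p = planePoint s (s • p) := by
  ext i
  fin_cases i <;> simp [planePoint] <;> ring

/-- Linear change of variables `(s, p) ↦ x` with determinant `-2√3`, followed by Fubini to separate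
the sum `s` from `p`. -/
theorem lintegral_eq_lintegral_planePoint (g : (Fin 3 → ℝ) → ℝ≥0∞) (hg : Measurable g) :
    ∫⁻ x, g x = ENNReal.ofReal (2 * √3) * ∫⁻ s : ℝ, ∫⁻ p : ℝ × ℝ, g (planePoint s p) := by
  set M : Matrix (Fin 3) (Fin 3) ℝ := !![1 / 3, 1, √3; 1 / 3, 1, -√3; 1 / 3, -2, 0] with hM
  have hdet : M.det = -(2 * √3) := by
    rw [hM, Matrix.det_fin_three]
    simp
    ring
  have h3 : (0 : ℝ) < 2 * √3 := by positivity
  have hmap := Real.map_matrix_volume_pi_eq_smul_volume_pi (M := M) (by rw [hdet]; linarith)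
  have hmeas : Measurable (Matrix.toLin' M) :=
    (LinearMap.continuous_of_finiteDimensional _).measurable
  have h1 : ∫⁻ x, g (Matrix.toLin' M x) = ENNReal.ofReal (2 * √3)⁻¹ * ∫⁻ x, g x := by
    rw [← lintegral_map hg hmeas, hmap, lintegral_smul_measure, hdet, abs_inv, abs_neg,
      abs_of_pos h3, smul_eq_mul]
  have h2 : ∫⁻ x, g (Matrix.toLin' M x) = ∫⁻ s : ℝ, ∫⁻ p : ℝ × ℝ, g (planePoint s p) := by
    rw [← (volume_preserving_piFinSuccAbove (fun _ : Fin 3 => ℝ) 0).symm.lintegral_comp_emb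
      (MeasurableEquiv.measurableEmbedding _), Measure.volume_eq_prod]
    refine (lintegral_prod _ (hg.comp (hmeas.comp
      (MeasurableEquiv.measurable _))).aemeasurable).trans ?_
    refine lintegral_congr fun s => ?_
    rw [← (volume_preserving_finTwoArrow ℝ).symm.lintegral_comp_emb
      (MeasurableEquiv.measurableEmbedding _)]
    refine lintegral_congr fun p => ?_
    refine congrArg g (funext fun i => ?_)
    fin_cases i <;>
      simp [hM, planePoint, Matrix.mulVec, dotProduct, Fin.sum_univ_three,
        MeasurableEquiv.piFinSuccAbove_symm_apply, Fin.insertNthEquiv, MeasurableEquiv.finTwoArrow,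
        MeasurableEquiv.piFinTwo] <;> ring
  rw [← h2, h1, ← mul_assoc, ← ENNReal.ofReal_mul h3.le, mul_inv_cancel₀ h3.ne', ENNReal.ofReal_one,
    one_mul]

theorem lintegral_eq_lintegral_smul {s : ℝ} (hs : 0 < s) (h : ℝ × ℝ → ℝ≥0∞) (hh : Measurable h) :
    ∫⁻ p, h p = ENNReal.ofReal (s ^ 2) * ∫⁻ p, h (s • p) := by
  have hmap := Measure.map_addHaar_smul (volume : Measure (ℝ × ℝ)) hs.ne'
  rw [← lintegral_map hh (measurable_const_smul s), hmap, lintegral_smul_measure, smul_eq_mul,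
    ← mul_assoc, ← ENNReal.ofReal_mul (by positivity)]
  have : s ^ 2 * |(s ^ Module.finrank ℝ (ℝ × ℝ))⁻¹| = 1 := by
    rw [Module.finrank_prod, Module.finrank_self, abs_of_pos (by positivity)]
    field_simp
  rw [this, ENNReal.ofReal_one, one_mul]

/-- The density of the symmetric Dirichlet distribution on the simplex, in the coordinates
`planePoint 1`, up to the Jacobian. -/
noncomputable def dirichletDensity (α : ℝ) (p : ℝ × ℝ) : ℝ≥0∞ :=
  if ∀ i, 0 ≤ planePoint 1 p i then
    ENNReal.ofReal (Real.Gamma (3 * α) / Real.Gamma α ^ 3 * ∏ i, planePoint 1 p i ^ (α - 1))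
  else 0

/-- Independence of the sum and the normalized sample: the exponentials combine because the
coordinates of `planePoint 1 p` sum to 1, and the powers of `s` collect into a gamma density of
shape `3α`. The factor `s²` is the Jacobian of rescaling the plane. -/
theorem prod_gammaPDF_smul_planePoint {α r s : ℝ} (hα : 0 < α) (hr : 0 < r) (hs : 0 < s)
    (p : ℝ × ℝ) :
    ENNReal.ofReal (s ^ 2) * ∏ i, gammaPDF α r ((s • planePoint 1 p) i) =
      gammaPDF (3 * α) r s * dirichletDensity α p := by
  have hΓ : 0 < Real.Gamma α := Real.Gamma_pos_of_pos hα
  have hΓ3 : 0 < Real.Gamma (3 * α) := Real.Gamma_pos_of_pos (by positivity)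
  have hsum : ∑ i, planePoint 1 p i = 1 := by
    simp [planePoint, Fin.sum_univ_three]
    ring
  unfold dirichletDensity
  generalize planePoint 1 p = y at hsum ⊢
  by_cases hy : ∀ i, 0 ≤ y i
  · have hpdf : ∀ i, gammaPDF α r ((s • y) i) = ENNReal.ofReal
        (r ^ α / Real.Gamma α * (s ^ (α - 1) * y i ^ (α - 1)) * Real.exp (-(r * (s * y i)))) :=
      fun i => by
        rw [Pi.smul_apply, smul_eq_mul, gammaPDF_of_nonneg (mul_nonneg hs.le (hy i)),
          Real.mul_rpow hs.le (hy i)]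
    have hpow : ∀ i, 0 ≤ y i ^ (α - 1) := fun i => Real.rpow_nonneg (hy i) _
    simp_rw [hpdf]
    rw [if_pos hy, gammaPDF_of_nonneg hs.le, ← ENNReal.ofReal_prod_of_nonneg
      (fun i _ => by have := hpow i; positivity), ← ENNReal.ofReal_mul (by positivity),
      ← ENNReal.ofReal_mul (by positivity)]
    congr 1
    have hr3 : r ^ (3 * α) = (r ^ α) ^ 3 := by
      rw [mul_comm, Real.rpow_mul hr.le]
      norm_cast
    have hs3 : s ^ (3 * α - 1) = s ^ 2 * (s ^ (α - 1)) ^ 3 := by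
      rw [← Real.rpow_natCast, ← Real.rpow_natCast, ← Real.rpow_mul hs.le, ← Real.rpow_add hs]
      congr 1
      push_cast
      ring
    have hexp : Real.exp (-(r * s)) = ∏ i, Real.exp (-(r * (s * y i))) := by
      rw [← Real.exp_sum, Finset.sum_neg_distrib, ← Finset.mul_sum, ← Finset.mul_sum, hsum, mul_one]
    rw [hr3, hs3, hexp]
    simp only [Fin.prod_univ_three]
    field_simp
  · rw [if_neg hy, mul_zero]
    obtain ⟨i, hi⟩ := not_forall.1 hy
    rw [Finset.prod_eq_zero (Finset.mem_univ i), mul_zero]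
    exact gammaPDF_of_neg (mul_neg_of_pos_of_neg hs (not_le.1 hi))

/-- The probability that a gamma sample of size three lies in a cone. -/
theorem pi_gammaMeasure_cone {α r : ℝ} (hα : 0 < α) (hr : 0 < r) {A : Set (Fin 3 → ℝ)}
    (hA : MeasurableSet A) (hcone : ∀ s : ℝ, 0 < s → ∀ x, s • x ∈ A ↔ x ∈ A) :
    Measure.pi (fun _ : Fin 3 => gammaMeasure α r) A =
      ENNReal.ofReal (2 * √3) * ∫⁻ p in planePoint 1 ⁻¹' A, dirichletDensity α p := by
  have hpdf : ∀ a, Measurable (gammaPDF a r) := fun a => (measurable_gammaPDFReal a r).ennreal_ofReal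
  have hm := hpdf α
  have := isProbabilityMeasure_gammaMeasure hα hr
  unfold gammaMeasure at this ⊢
  have hmp : Measurable fun x : Fin 3 → ℝ => ∏ i, gammaPDF α r (x i) :=
    Finset.measurable_prod _ fun i _ => hm.comp (measurable_pi_apply i)
  rw [pi_withDensity_volume _ fun _ => hm, withDensity_apply _ hA, ← lintegral_indicator hA,
    lintegral_eq_lintegral_planePoint _ (hmp.indicator hA)]
  congr 1
  have hslice : ∀ᵐ s : ℝ, ∫⁻ p, A.indicator (fun x => ∏ i, gammaPDF α r (x i)) (planePoint s p) =
      gammaPDF (3 * α) r s * ∫⁻ p in planePoint 1 ⁻¹' A, dirichletDensity α p := by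
    -- For `s < 0` some coordinate is negative and the density vanishes; for `s > 0` rescaling by
    -- `s` carries the slice to sum 1, where the cone condition keeps `A` unchanged.
    filter_upwards [Measure.ae_ne volume 0] with s hs0
    rcases lt_or_gt_of_ne hs0 with hs | hs
    · rw [gammaPDF_of_neg hs, zero_mul]
      refine (lintegral_congr fun p => ?_).trans lintegral_zero
      refine Set.indicator_apply_eq_zero.2 fun _ => ?_
      obtain ⟨i, hi⟩ : ∃ i, planePoint s p i < 0 := by
        by_contra! h
        have h0 := h 0
        have h1 := h 1
        have h2 := h 2
        simp [planePoint] at h0 h1 h2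
        linarith
      exact Finset.prod_eq_zero (Finset.mem_univ i) (gammaPDF_of_neg hi)
    · have htop : gammaPDF (3 * α) r s ≠ ⊤ := ENNReal.ofReal_ne_top
      refine (lintegral_eq_lintegral_smul hs _
        ((hmp.indicator hA).comp (measurable_planePoint s))).trans ?_
      rw [← lintegral_indicator (measurable_planePoint 1 hA), ← lintegral_const_mul' _ _
        ENNReal.ofReal_ne_top, ← lintegral_const_mul' _ _ htop]
      refine lintegral_congr fun p => ?_
      rw [Function.comp_apply, ← smul_planePoint]
      by_cases hp : planePoint 1 p ∈ A
      · rw [Set.indicator_of_mem ((hcone s hs _).2 hp), Set.indicator_of_mem (by exact hp),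
          prod_gammaPDF_smul_planePoint hα hr hs]
      · rw [Set.indicator_of_notMem (fun h => hp ((hcone s hs _).1 h)),
          Set.indicator_of_notMem (by exact hp), mul_zero, mul_zero]
  rw [lintegral_congr_ae hslice, lintegral_mul_const _ (hpdf _), lintegral_gammaPDF_eq_one (by positivity) hr,
    one_mul]

/-! ### Integrals over discs and areas of circular segments -/

/-- The open Euclidean disc of squared radius `Q` about the origin. -/
def euclideanDisc (Q : ℝ) : Set (ℝ × ℝ) :=
  {p | p.1 ^ 2 + p.2 ^ 2 < Q}

theorem measurableSet_euclideanDisc (Q : ℝ) : MeasurableSet (euclideanDisc Q) :=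
  measurableSet_lt (by fun_prop) measurable_const

theorem euclideanDisc_subset_prod (Q : ℝ) :
    euclideanDisc Q ⊆ Set.Icc (-√Q) √Q ×ˢ Set.Icc (-√Q) √Q := by
  intro p hp
  have hp' : p.1 ^ 2 + p.2 ^ 2 < Q := hp
  rw [Set.mem_prod, Set.mem_Icc, Set.mem_Icc, ← abs_le, ← abs_le]
  exact ⟨Real.abs_le_sqrt (by nlinarith), Real.abs_le_sqrt (by nlinarith)⟩

theorem Continuous.integrableOn_euclideanDisc {f : ℝ × ℝ → ℝ} (hf : Continuous f) (Q : ℝ) :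
    IntegrableOn f (euclideanDisc Q) :=
  (hf.continuousOn.integrableOn_compact (isCompact_Icc.prod isCompact_Icc)).mono_set
    (euclideanDisc_subset_prod Q)

theorem setIntegral_euclideanDisc_radial {Q : ℝ} (hQ : 0 ≤ Q) (a b : ℝ) :
    ∫ p in euclideanDisc Q, (a + b * (p.1 ^ 2 + p.2 ^ 2)) = Real.pi * (a * Q + b * Q ^ 2 / 2) := by
  rw [← integral_indicator (measurableSet_euclideanDisc Q), ← integral_comp_polarCoord_symm]
  have hpt : ∀ p : ℝ × ℝ, p.1 • (euclideanDisc Q).indicator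
      (fun p => a + b * (p.1 ^ 2 + p.2 ^ 2)) (polarCoord.symm p) =
      {r : ℝ | r ^ 2 < Q}.indicator (fun r => r * (a + b * r ^ 2)) p.1 * (fun _ => 1) p.2 := by
    intro p
    have hr : (p.1 * Real.cos p.2) ^ 2 + (p.1 * Real.sin p.2) ^ 2 = p.1 ^ 2 := by
      linear_combination p.1 ^ 2 * Real.sin_sq_add_cos_sq p.2
    simp [Set.indicator_apply, euclideanDisc, polarCoord_symm_apply, hr]
  simp_rw [hpt]
  rw [polarCoord_target, Measure.volume_eq_prod, setIntegral_prod_mul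
      ({r : ℝ | r ^ 2 < Q}.indicator fun r => r * (a + b * r ^ 2)) (fun _ => (1 : ℝ)),
    setIntegral_indicator (measurableSet_lt (by fun_prop) measurable_const)]
  have hset : Set.Ioi (0 : ℝ) ∩ {r : ℝ | r ^ 2 < Q} = Set.Ioo 0 √Q := by
    ext r
    simp only [Set.mem_inter_iff, Set.mem_Ioi, Set.mem_ofPred_eq, Set.mem_Ioo]
    exact and_congr_right fun h => (Real.lt_sqrt h.le).symm
  rw [hset, ← integral_Ioc_eq_integral_Ioo, ← intervalIntegral.integral_of_le (Real.sqrt_nonneg Q)]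
  have hint : ∫ r in (0 : ℝ)..√Q, r * (a + b * r ^ 2) = a * Q / 2 + b * Q ^ 2 / 4 := by
    rw [intervalIntegral.integral_eq_sub_of_hasDerivAt
      (f := fun r => a * r ^ 2 / 2 + b * r ^ 4 / 4)]
    · have h4 : √Q ^ 4 = Q ^ 2 := by rw [← Real.sq_sqrt hQ]; ring_nf; simp
      simp [Real.sq_sqrt hQ, h4]
    · intro r _
      have := (((hasDerivAt_pow 2 r).const_mul a).div_const 2).add
        (((hasDerivAt_pow 4 r).const_mul b).div_const 4)
      refine this.congr_deriv ?_
      push_cast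
      ring
    · exact (by fun_prop : Continuous fun r : ℝ => r * (a + b * r ^ 2)).intervalIntegrable _ _
  rw [hint]
  simp
  rw [max_eq_left (by positivity)]
  ring

theorem volume_euclideanDisc {Q : ℝ} (hQ : 0 ≤ Q) :
    volume (euclideanDisc Q) = ENNReal.ofReal (Real.pi * Q) := by
  have h := setIntegral_euclideanDisc_radial hQ 1 0
  have hfin : volume (euclideanDisc Q) ≠ ⊤ :=
    (measure_mono (euclideanDisc_subset_prod Q)).trans_lt
      (isCompact_Icc.prod isCompact_Icc).measure_lt_top |>.ne
  simp only [zero_mul, add_zero, setIntegral_const, smul_eq_mul, mul_one, zero_div, one_mul] at h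
  rw [← h, measureReal_def, ENNReal.ofReal_toReal hfin]

theorem setIntegral_euclideanDisc_eq_zero_of_odd {f : ℝ × ℝ → ℝ} (hf : ∀ p, f (-p) = -f p)
    (Q : ℝ) : ∫ p in euclideanDisc Q, f p = 0 := by
  rw [← integral_indicator (measurableSet_euclideanDisc Q)]
  have h := integral_neg_eq_self ((euclideanDisc Q).indicator f) (volume : Measure (ℝ × ℝ))
  have hodd : ∀ p, (euclideanDisc Q).indicator f (-p) = -(euclideanDisc Q).indicator f p := by
    intro p
    have hiff : -p ∈ euclideanDisc Q ↔ p ∈ euclideanDisc Q := by simp [euclideanDisc]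
    by_cases hp : p ∈ euclideanDisc Q
    · rw [Set.indicator_of_mem hp, Set.indicator_of_mem (hiff.2 hp), hf]
    · rw [Set.indicator_of_notMem hp, Set.indicator_of_notMem (mt hiff.1 hp), neg_zero]
  simp_rw [hodd, integral_neg] at h
  linarith

theorem integral_two_mul_sqrt_sq_sub_sq {d R : ℝ} (hd : 0 < d) (hdR : d ≤ R) :
    ∫ u in d..R, 2 * √(R ^ 2 - u ^ 2) = R ^ 2 * Real.arccos (d / R) - d * √(R ^ 2 - d ^ 2) := by
  have hR : 0 < R := hd.trans_le hdR
  have hc : Continuous fun u : ℝ => 2 * √(R ^ 2 - u ^ 2) := by fun_prop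
  -- The derivative is needed only in the open interval: neither summand of the antiderivative is
  -- differentiable at `u = R`.
  rw [intervalIntegral.integral_eq_sub_of_hasDerivAt_of_le (a := d) (b := R) hdR
      (f := fun u => R ^ 2 * Real.arcsin (u / R) + u * √(R ^ 2 - u ^ 2))]
  · simp only [div_self hR.ne', Real.arcsin_one, sub_self, Real.sqrt_zero, mul_zero, add_zero,
      Real.arccos]
    ring
  · fun_prop
  · intro u hu
    have hu0 : 0 < u := hd.trans hu.1
    have hlt : u / R < 1 := (div_lt_one hR).2 hu.2
    have hgt : 0 < u / R := div_pos hu0 hR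
    have hpos : 0 < R ^ 2 - u ^ 2 := by nlinarith [hu.2]
    have h1 := (((Real.hasDerivAt_arcsin (by linarith) hlt.ne).comp u
      ((hasDerivAt_id u).div_const R)).const_mul (R ^ 2)).add
      ((hasDerivAt_id u).mul (((hasDerivAt_pow 2 u).const_sub (R ^ 2)).sqrt hpos.ne'))
    refine h1.congr_deriv ?_
    have hs : √(1 - (u / R) ^ 2) = √(R ^ 2 - u ^ 2) / R := by
      rw [show 1 - (u / R) ^ 2 = (R ^ 2 - u ^ 2) / R ^ 2 by field_simp, Real.sqrt_div hpos.le,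
        Real.sqrt_sq hR.le]
    have hs0 : 0 < √(R ^ 2 - u ^ 2) := Real.sqrt_pos.2 hpos
    have hsq := Real.sq_sqrt hpos.le
    simp only [id, hs]
    field_simp
    push_cast
    linear_combination -2 * hsq
  · exact hc.intervalIntegrable _ _

/-- The area cut from the disc of radius `R` by a line at distance `d` from its centre. -/
theorem volume_circularSegment {d R : ℝ} (hd : 0 < d) (hdR : d ≤ R) :
    volume (euclideanDisc (R ^ 2) ∩ {p | d < p.1}) =
      ENNReal.ofReal (R ^ 2 * Real.arccos (d / R) - d * √(R ^ 2 - d ^ 2)) := by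
  have hset : euclideanDisc (R ^ 2) ∩ {p | d < p.1} =
      regionBetween (fun u => -√(R ^ 2 - u ^ 2)) (fun u => √(R ^ 2 - u ^ 2)) (Set.Ioc d R) := by
    ext p
    simp only [euclideanDisc, regionBetween, Set.mem_inter_iff, Set.mem_ofPred_eq, Set.mem_Ioc,
      Set.mem_Ioo]
    rw [← Real.sq_lt]
    constructor
    · rintro ⟨h1, h2⟩
      exact ⟨⟨h2, by nlinarith [sq_nonneg p.2]⟩, by linarith⟩
    · rintro ⟨⟨h1, -⟩, h2⟩
      exact ⟨by linarith, h1⟩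
  have hc : Continuous fun u : ℝ => √(R ^ 2 - u ^ 2) := by fun_prop
  have hi : IntegrableOn (fun u : ℝ => √(R ^ 2 - u ^ 2)) (Set.Ioc d R) :=
    (hc.continuousOn.integrableOn_compact isCompact_Icc).mono_set Set.Ioc_subset_Icc_self
  rw [hset, Measure.volume_eq_prod, volume_regionBetween_eq_integral
    (f := fun u => -√(R ^ 2 - u ^ 2)) hi.neg hi measurableSet_Ioc
    fun u _ => by linarith [Real.sqrt_nonneg (R ^ 2 - u ^ 2)]]
  congr 1
  rw [← intervalIntegral.integral_of_le hdR, ← integral_two_mul_sqrt_sq_sub_sq hd hdR]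
  exact intervalIntegral.integral_congr fun u _ => by simp only [Pi.sub_apply]; ring

theorem circularSegment_area_nonneg {d R : ℝ} (hd : 0 < d) (hdR : d ≤ R) :
    0 ≤ R ^ 2 * Real.arccos (d / R) - d * √(R ^ 2 - d ^ 2) := by
  rw [← integral_two_mul_sqrt_sq_sub_sq hd hdR]
  exact intervalIntegral.integral_nonneg hdR fun u _ => by positivity

/-- Leaving the sign of `c = ±√3` open covers the rotations by both `2π/3` and `-2π/3`. -/
theorem volume_preimage_rotation {c : ℝ} (hc : c ^ 2 = 3) (S : Set (ℝ × ℝ)) :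
    volume ((fun p : ℝ × ℝ => (-(1 / 2) * p.1 + -(c / 2) * p.2, c / 2 * p.1 + -(1 / 2) * p.2)) ⁻¹' S) =
      volume S := by
  set L : ℝ × ℝ →ₗ[ℝ] ℝ × ℝ := Matrix.toLin (Module.Basis.finTwoProd ℝ) (Module.Basis.finTwoProd ℝ)
    !![-(1 / 2), -(c / 2); c / 2, -(1 / 2)] with hL
  have hdet : LinearMap.det L = 1 := by
    rw [hL, LinearMap.det_toLin, Matrix.det_fin_two_of]
    linear_combination (1 / 4) * hc
  have hfun : (fun p : ℝ × ℝ => (-(1 / 2) * p.1 + -(c / 2) * p.2, c / 2 * p.1 + -(1 / 2) * p.2)) = L :=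
    funext fun p => (Matrix.toLin_finTwoProd_apply _ _ _ _ p).symm
  rw [hfun, Measure.addHaar_preimage_linearMap _ (by rw [hdet]; exact one_ne_zero), hdet]
  simp

/-- The threefold symmetry of the triangle carries each side to the side `p.1 = 1/6`. -/
theorem volume_euclideanDisc_inter_coord_neg (Q : ℝ) (i : Fin 3) :
    volume (euclideanDisc Q ∩ {p | planePoint 1 p i < 0}) =
      volume (euclideanDisc Q ∩ {p | 1 / 6 < p.1}) := by
  have h3 : √3 ^ 2 = (3 : ℝ) := Real.sq_sqrt (by norm_num)
  have key : ∀ c : ℝ, c ^ 2 = 3 → volume (euclideanDisc Q ∩ {p | 1 / 3 + p.1 + c * p.2 < 0}) =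
      volume (euclideanDisc Q ∩ {p | 1 / 6 < p.1}) := by
    intro c hc
    rw [← volume_preimage_rotation hc (euclideanDisc Q ∩ {p | 1 / 6 < p.1})]
    congr 1
    ext p
    simp only [euclideanDisc, Set.mem_inter_iff, Set.mem_ofPred_eq, Set.mem_preimage]
    refine and_congr ?_ ?_
    · rw [show (-(1 / 2) * p.1 + -(c / 2) * p.2) ^ 2 + (c / 2 * p.1 + -(1 / 2) * p.2) ^ 2 =
        p.1 ^ 2 + p.2 ^ 2 by linear_combination (1 / 4) * (p.1 ^ 2 + p.2 ^ 2) * hc]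
    · constructor <;> intro h <;> linarith
  fin_cases i
  · simpa [planePoint] using key √3 h3
  · simpa [planePoint, sub_eq_add_neg] using key (-√3) (by rw [neg_sq, h3])
  · congr 2
    ext p
    change 1 / 3 - 2 * p.1 < 0 ↔ 1 / 6 < p.1
    constructor <;> intro h <;> linarith

/-! ### Disc probabilities for shapes 1 and 2 -/

/-- The points whose image under `planePoint 1` lies in the standard simplex. -/
def simplexRegion : Set (ℝ × ℝ) :=
  {p | ∀ i, 0 ≤ planePoint 1 p i}

theorem measurable_planePoint_apply (s : ℝ) (i : Fin 3) : Measurable fun p => planePoint s p i :=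
  (measurable_pi_apply i).comp (measurable_planePoint s)

theorem measurableSet_simplexRegion : MeasurableSet simplexRegion := by
  have : simplexRegion = ⋂ i, {p | 0 ≤ planePoint 1 p i} := by
    ext p
    simp [simplexRegion]
  rw [this]
  exact MeasurableSet.iInter fun i =>
    measurableSet_le measurable_const (measurable_planePoint_apply 1 i)

theorem sum_planePoint (s : ℝ) (p : ℝ × ℝ) : ∑ i, planePoint s p i = s := by
  simp [planePoint, Fin.sum_univ_three]
  ring

theorem sum_sq_planePoint (s : ℝ) (p : ℝ × ℝ) :
    ∑ i, planePoint s p i ^ 2 = s ^ 2 / 3 + 6 * (p.1 ^ 2 + p.2 ^ 2) := by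
  have h3 : √3 ^ 2 = (3 : ℝ) := Real.sq_sqrt (by norm_num)
  simp [planePoint, Fin.sum_univ_three]
  linear_combination (2 * p.2 ^ 2) * h3

/-- The three overhanging segments are disjoint: two negative coordinates would force the third
above 1, while the sum of squares is below `1/3 + 6R² ≤ 1`. -/
theorem volume_euclideanDisc_inter_simplexRegion {R : ℝ} (h1 : 1 / 6 ≤ R) (h2 : R ^ 2 ≤ 1 / 9) :
    volume (euclideanDisc (R ^ 2) ∩ simplexRegion) = ENNReal.ofReal (Real.pi * R ^ 2 -
      3 * (R ^ 2 * Real.arccos (1 / 6 / R) - 1 / 6 * √(R ^ 2 - (1 / 6) ^ 2))) := by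
  have hdiff : euclideanDisc (R ^ 2) \ simplexRegion =
      ⋃ i, euclideanDisc (R ^ 2) ∩ {p | planePoint 1 p i < 0} := by
    ext p
    simp [simplexRegion]
  have hdisj : Pairwise (Function.onFun Disjoint
      fun i => euclideanDisc (R ^ 2) ∩ {p | planePoint 1 p i < 0}) := by
    intro i j hij
    refine Set.disjoint_left.2 ?_
    rintro p ⟨hp, hi⟩ ⟨-, hj⟩
    have hp' : p.1 ^ 2 + p.2 ^ 2 < R ^ 2 := hp
    have hi' : planePoint 1 p i < 0 := hi
    have hj' : planePoint 1 p j < 0 := hj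
    have hs := sum_planePoint 1 p
    have hq := sum_sq_planePoint 1 p
    rw [Fin.sum_univ_three] at hs hq
    fin_cases i <;> fin_cases j <;> first | exact hij rfl | (simp at hi' hj'; nlinarith)
  have hvd := volume_euclideanDisc (sq_nonneg R)
  have hfin : volume (euclideanDisc (R ^ 2)) ≠ ⊤ := by rw [hvd]; exact ENNReal.ofReal_ne_top
  have hmeas : volume (euclideanDisc (R ^ 2) \ simplexRegion) =
      3 * ENNReal.ofReal (R ^ 2 * Real.arccos (1 / 6 / R) - 1 / 6 * √(R ^ 2 - (1 / 6) ^ 2)) := by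
    rw [hdiff, measure_iUnion hdisj fun i => (measurableSet_euclideanDisc _).inter
      (measurableSet_lt (measurable_planePoint_apply 1 i) measurable_const), tsum_fintype]
    simp_rw [volume_euclideanDisc_inter_coord_neg]
    rw [volume_circularSegment (by norm_num) h1]
    simp
  have hseg : 0 ≤ R ^ 2 * Real.arccos (1 / 6 / R) - 1 / 6 * √(R ^ 2 - (1 / 6) ^ 2) :=
    circularSegment_area_nonneg (by norm_num) h1
  have hadd := measure_inter_add_sdiff (μ := (volume : Measure (ℝ × ℝ))) (euclideanDisc (R ^ 2))
    measurableSet_simplexRegion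
  rw [hmeas, hvd, show (3 : ℝ≥0∞) = ENNReal.ofReal 3 by simp, ← ENNReal.ofReal_mul (by norm_num)]
    at hadd
  rw [ENNReal.ofReal_sub _ (by positivity), ← hadd, ENNReal.add_sub_cancel_right
    ENNReal.ofReal_ne_top]

/-- The Dirichlet probability of the disc of squared radius `Q` in the simplex, which is the
upper tail probability of the shape statistics. -/
noncomputable def discTail (α Q : ℝ) : ℝ :=
  (ENNReal.ofReal (2 * √3) * ∫⁻ p in euclideanDisc Q, dirichletDensity α p).toReal

theorem discTail_one {R : ℝ} (h1 : 1 / 6 ≤ R) (h2 : R ^ 2 ≤ 1 / 9) :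
    discTail 1 (R ^ 2) = 4 * √3 * (Real.pi * R ^ 2 -
      3 * (R ^ 2 * Real.arccos (1 / 6 / R) - 1 / 6 * √(R ^ 2 - (1 / 6) ^ 2))) := by
  have hD : ∀ p, dirichletDensity 1 p = simplexRegion.indicator (fun _ => ENNReal.ofReal 2) p := by
    intro p
    simp [dirichletDensity, simplexRegion, Set.indicator_apply]
  have hpos : 0 ≤ Real.pi * R ^ 2 -
      3 * (R ^ 2 * Real.arccos (1 / 6 / R) - 1 / 6 * √(R ^ 2 - (1 / 6) ^ 2)) := by
    -- As `R ≤ 1/3`, the three sectors over the segments fill at most the whole disc.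
    have : Real.arccos (1 / 6 / R) ≤ Real.pi / 3 := by
      have hR : R ≤ 1 / 3 := abs_le_of_sq_le_sq' (by linarith) (by norm_num) |>.2
      have h : Real.arccos (1 / 2) = Real.pi / 3 := by
        rw [← Real.cos_pi_div_three, Real.arccos_cos] <;> linarith [Real.pi_pos]
      rw [← h]
      refine Real.arccos_le_arccos ?_
      rw [le_div_iff₀ (by linarith)]
      linarith
    have := mul_le_mul_of_nonneg_left this (sq_nonneg R)
    have := Real.sqrt_nonneg (R ^ 2 - (1 / 6) ^ 2)
    linarith
  unfold discTail
  simp_rw [hD]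
  rw [setLIntegral_indicator measurableSet_simplexRegion, setLIntegral_const, Set.inter_comm,
    volume_euclideanDisc_inter_simplexRegion h1 h2, ENNReal.toReal_mul, ENNReal.toReal_mul,
    ENNReal.toReal_ofReal (by positivity), ENNReal.toReal_ofReal (by positivity),
    ENNReal.toReal_ofReal hpos]
  ring

theorem euclideanDisc_subset_simplexRegion {Q : ℝ} (hQ : Q ≤ 1 / 36) :
    euclideanDisc Q ⊆ simplexRegion := by
  intro p hp
  have hp' : p.1 ^ 2 + p.2 ^ 2 < Q := hp
  have h3 : √3 ^ 2 = (3 : ℝ) := Real.sq_sqrt (by norm_num)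
  have h0 : |p.1 + √3 * p.2| < 1 / 3 := abs_lt_of_sq_lt_sq
    (by nlinarith [sq_nonneg (√3 * p.1 - p.2)]) (by norm_num)
  have h1 : |p.1 - √3 * p.2| < 1 / 3 := abs_lt_of_sq_lt_sq
    (by nlinarith [sq_nonneg (√3 * p.1 + p.2)]) (by norm_num)
  have h2 : |2 * p.1| < 1 / 3 := abs_lt_of_sq_lt_sq (by nlinarith [sq_nonneg p.2]) (by norm_num)
  rw [abs_lt] at h0 h1 h2
  intro i
  fin_cases i
  · change 0 ≤ 1 / 3 + p.1 + √3 * p.2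
    linarith
  · change 0 ≤ 1 / 3 + p.1 - √3 * p.2
    linarith
  · change 0 ≤ 1 / 3 - 2 * p.1
    linarith

/-- Splits the product into a radial part and a cubic that is odd under `p ↦ -p`. -/
theorem prod_planePoint_one (p : ℝ × ℝ) : ∏ i, planePoint 1 p i =
    (1 / 27 + (-1) * (p.1 ^ 2 + p.2 ^ 2)) + -(2 * p.1 * (p.1 ^ 2 - 3 * p.2 ^ 2)) := by
  have h3 : √3 ^ 2 = (3 : ℝ) := Real.sq_sqrt (by norm_num)
  rw [Fin.prod_univ_three]
  change (1 / 3 + p.1 + √3 * p.2) * (1 / 3 + p.1 - √3 * p.2) * (1 / 3 - 2 * p.1) = _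
  linear_combination (-(1 / 3 - 2 * p.1) * p.2 ^ 2) * h3

theorem discTail_two {Q : ℝ} (h0 : 0 ≤ Q) (h1 : Q ≤ 1 / 36) :
    discTail 2 Q = 240 * √3 * (Real.pi * (Q / 27 - Q ^ 2 / 2)) := by
  have hG6 : Real.Gamma 6 = 120 := by
    simp [Nat.factorial]
  have hG2 : Real.Gamma 2 = 1 := Real.Gamma_two
  have hD : ∀ p ∈ euclideanDisc Q, dirichletDensity 2 p =
      ENNReal.ofReal (120 * ∏ i, planePoint 1 p i) := by
    intro p hp
    have hs : ∀ i, 0 ≤ planePoint 1 p i := euclideanDisc_subset_simplexRegion h1 hp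
    rw [dirichletDensity, if_pos hs]
    norm_num [hG6, hG2]
  have hnonneg : ∀ p ∈ euclideanDisc Q, 0 ≤ 120 * ∏ i, planePoint 1 p i := fun p hp =>
    mul_nonneg (by norm_num)
      (Finset.prod_nonneg fun i _ => euclideanDisc_subset_simplexRegion h1 hp i)
  have hc1 : Continuous fun p : ℝ × ℝ => 1 / 27 + (-1) * (p.1 ^ 2 + p.2 ^ 2) := by fun_prop
  have hc2 : Continuous fun p : ℝ × ℝ => -(2 * p.1 * (p.1 ^ 2 - 3 * p.2 ^ 2)) := by fun_prop
  have hint : IntegrableOn (fun p => 120 * ∏ i, planePoint 1 p i) (euclideanDisc Q) := by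
    simp_rw [prod_planePoint_one]
    exact ((hc1.add hc2).const_mul 120).integrableOn_euclideanDisc Q
  have hval : ∫ p in euclideanDisc Q, 120 * ∏ i, planePoint 1 p i =
      120 * (Real.pi * (Q / 27 - Q ^ 2 / 2)) := by
    simp_rw [prod_planePoint_one]
    rw [integral_const_mul, integral_add (hc1.integrableOn_euclideanDisc Q)
      (hc2.integrableOn_euclideanDisc Q), setIntegral_euclideanDisc_radial h0,
      setIntegral_euclideanDisc_eq_zero_of_odd (fun p => by simp)]
    ring
  unfold discTail
  rw [setLIntegral_congr_fun (measurableSet_euclideanDisc Q) hD,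
    ← ofReal_integral_eq_lintegral_ofReal hint
      ((ae_restrict_iff' (measurableSet_euclideanDisc Q)).2 (Filter.Eventually.of_forall hnonneg)),
    ENNReal.toReal_mul, ENNReal.toReal_ofReal (by positivity), ENNReal.toReal_ofReal
      (setIntegral_nonneg (measurableSet_euclideanDisc Q) hnonneg), hval]
  ring

/-! ### Distribution functions of the two statistics -/

theorem cdf_gammaSampleLaw_of_disc {stat : (Fin 3 → ℝ) → ℝ} {c Q α lam : ℝ} (hα : 0 < α)
    (hlam : 0 < lam) (hmeas : Measurable stat)
    (hscale : ∀ s : ℝ, 0 < s → ∀ x, stat (s • x) = stat x)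
    (hdisc : ∀ p : ℝ × ℝ, p ≠ 0 → (c < stat (planePoint 1 p) ↔ p ∈ euclideanDisc Q)) :
    cdf (gammaSampleLaw 3 stat α lam) c = 1 - discTail α Q := by
  have hp := isProbabilityMeasure_gammaMeasure hα (inv_pos.2 hlam)
  have hprob : IsProbabilityMeasure (gammaSampleLaw 3 stat α lam) :=
    Measure.isProbabilityMeasure_map hmeas.aemeasurable
  have hA : MeasurableSet {x | c < stat x} := measurableSet_lt measurable_const hmeas
  have hset : (planePoint 1 ⁻¹' {x | c < stat x} : Set (ℝ × ℝ)) =ᵐ[volume] euclideanDisc Q := by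
    -- At `p = 0` the variance is zero and the quotient takes the default value 0, so the disc
    -- description can fail there; a single point is null.
    filter_upwards [Measure.ae_ne volume (0 : ℝ × ℝ)] with p hp0
    exact propext (hdisc p hp0)
  rw [cdf_eq_real, ← compl_compl (Set.Iic c), probReal_compl_eq_one_sub measurableSet_Iic.compl,
    Set.compl_Iic, measureReal_def, gammaSampleLaw, Measure.map_apply hmeas measurableSet_Ioi,
    show stat ⁻¹' Set.Ioi c = {x | c < stat x} from rfl,
    pi_gammaMeasure_cone hα (inv_pos.2 hlam) hA (fun s hs x => by simp [hscale s hs x]),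
    setLIntegral_congr hset, discTail]

theorem measurable_sampleMean {n : ℕ} : Measurable (sampleMean (n := n)) := by
  unfold sampleMean
  fun_prop

theorem measurable_sampleVar {n : ℕ} : Measurable (sampleVar (n := n)) := by
  have := measurable_sampleMean (n := n)
  unfold sampleVar
  fun_prop

theorem sampleMean_smul {n : ℕ} (s : ℝ) (x : Fin n → ℝ) :
    sampleMean (s • x) = s * sampleMean x := by
  simp [sampleMean, ← Finset.mul_sum, mul_div_assoc]

theorem sampleVar_smul {n : ℕ} (s : ℝ) (x : Fin n → ℝ) :
    sampleVar (s • x) = s ^ 2 * sampleVar x := by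
  simp [sampleVar, sampleMean_smul, ← mul_sub, mul_pow, ← Finset.mul_sum, mul_div_assoc]

theorem alphaHat_smul {n : ℕ} {s : ℝ} (hs : 0 < s) (x : Fin n → ℝ) :
    alphaHat (s • x) = alphaHat x := by
  rw [alphaHat, alphaHat, sampleMean_smul, sampleVar_smul, mul_pow,
    mul_div_mul_left _ _ (by positivity)]

theorem meanStdRatio_smul {n : ℕ} {s : ℝ} (hs : 0 < s) (x : Fin n → ℝ) :
    meanStdRatio (s • x) = meanStdRatio x := by
  rw [meanStdRatio, meanStdRatio, sampleMean_smul, sampleVar_smul, Real.sqrt_mul (sq_nonneg s),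
    Real.sqrt_sq hs.le, mul_div_mul_left _ _ hs.ne']

theorem sampleMean_planePoint (p : ℝ × ℝ) : sampleMean (planePoint 1 p) = 1 / 3 := by
  rw [sampleMean, sum_planePoint]
  norm_num

theorem sampleVar_planePoint (p : ℝ × ℝ) :
    sampleVar (planePoint 1 p) = 2 * (p.1 ^ 2 + p.2 ^ 2) := by
  have h1 := sum_planePoint 1 p
  have h2 := sum_sq_planePoint 1 p
  rw [sampleVar, sampleMean_planePoint]
  rw [Fin.sum_univ_three] at h1 h2 ⊢
  push_cast
  linear_combination (1 / 3) * h2 - (2 / 9) * h1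

theorem sq_add_sq_pos_of_ne_zero {p : ℝ × ℝ} (hp : p ≠ 0) : 0 < p.1 ^ 2 + p.2 ^ 2 := by
  by_contra! h
  refine hp (Prod.ext ?_ ?_) <;> simp <;> nlinarith [sq_nonneg p.1, sq_nonneg p.2]

theorem cdf_alphaHat {α lam t : ℝ} (hα : 0 < α) (hlam : 0 < lam) (ht : 0 < t) :
    cdf (gammaSampleLaw 3 alphaHat α lam) t = 1 - discTail α (1 / (18 * t)) := by
  refine cdf_gammaSampleLaw_of_disc hα hlam ?_ (fun s hs x => alphaHat_smul hs x) fun p hp => ?_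
  · exact (measurable_sampleMean.pow_const 2).div measurable_sampleVar
  · have hpos := sq_add_sq_pos_of_ne_zero hp
    rw [alphaHat, sampleMean_planePoint, sampleVar_planePoint, euclideanDisc, Set.mem_ofPred_eq,
      lt_div_iff₀ (by positivity), lt_div_iff₀ (by positivity)]
    constructor <;> intro h <;> linarith

theorem cdf_meanStdRatio {α lam t : ℝ} (hα : 0 < α) (hlam : 0 < lam) (ht : 0 < t) :
    cdf (gammaSampleLaw 3 meanStdRatio α lam) t = 1 - discTail α (1 / (18 * t ^ 2)) := by
  refine cdf_gammaSampleLaw_of_disc hα hlam ?_ (fun s hs x => meanStdRatio_smul hs x)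
    fun p hp => ?_
  · exact measurable_sampleMean.div measurable_sampleVar.sqrt
  · have hpos := sq_add_sq_pos_of_ne_zero hp
    rw [meanStdRatio, sampleMean_planePoint, sampleVar_planePoint, euclideanDisc,
      Set.mem_ofPred_eq, lt_div_iff₀ (by positivity), ← lt_div_iff₀' ht, Real.sqrt_lt' (by positivity),
      lt_div_iff₀ (by positivity), div_div, div_pow, lt_div_iff₀ (by positivity)]
    constructor <;> intro h <;> linarith

/-! ### Quantile enclosure and numerical bounds -/

theorem quantile_mem_Icc {ν : Measure ℝ} {u a b : ℝ} (ha : cdf ν a < u) (hb : u ≤ cdf ν b) :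
    quantile ν u ∈ Set.Icc a b := by
  have hlow : ∀ y ∈ {y : ℝ | u ≤ cdf ν y}, a ≤ y := fun y hy => by
    by_contra! h
    exact absurd (hy.trans ((cdf ν).mono h.le)) (not_le.2 ha)
  exact ⟨le_csInf ⟨b, hb⟩ hlow, csInf_le ⟨a, hlow⟩ hb⟩

/-- The difference of the two sides has derivative `y⁶ / (1 + y²) ≥ 0`. -/
theorem arctan_le_taylor {x : ℝ} (hx : 0 ≤ x) : Real.arctan x ≤ x - x ^ 3 / 3 + x ^ 5 / 5 := by
  have hd : ∀ y : ℝ, HasDerivAt (fun z => z - z ^ 3 / 3 + z ^ 5 / 5 - Real.arctan z)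
      (1 - y ^ 2 + y ^ 4 - 1 / (1 + y ^ 2)) y := fun y => by
    refine ((((hasDerivAt_id y).sub ((hasDerivAt_pow 3 y).div_const 3)).add
      ((hasDerivAt_pow 5 y).div_const 5)).sub (Real.hasDerivAt_arctan y)).congr_deriv ?_
    push_cast
    ring
  have hmono := monotone_of_deriv_nonneg (fun y => (hd y).differentiableAt) fun y => by
    rw [(hd y).deriv, show 1 - y ^ 2 + y ^ 4 - 1 / (1 + y ^ 2) = y ^ 6 / (1 + y ^ 2) by
      field_simp
      ring]
    positivity
  have := hmono hx
  simp at this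
  linarith

theorem taylor_le_arctan {x : ℝ} (hx : 0 ≤ x) :
    x - x ^ 3 / 3 + x ^ 5 / 5 - x ^ 7 / 7 ≤ Real.arctan x := by
  have hd : ∀ y : ℝ, HasDerivAt (fun z => Real.arctan z - (z - z ^ 3 / 3 + z ^ 5 / 5 - z ^ 7 / 7))
      (1 / (1 + y ^ 2) - (1 - y ^ 2 + y ^ 4 - y ^ 6)) y := fun y => by
    refine ((Real.hasDerivAt_arctan y).sub ((((hasDerivAt_id y).sub
      ((hasDerivAt_pow 3 y).div_const 3)).add ((hasDerivAt_pow 5 y).div_const 5)).sub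
      ((hasDerivAt_pow 7 y).div_const 7))).congr_deriv ?_
    push_cast
    ring
  have hmono := monotone_of_deriv_nonneg (fun y => (hd y).differentiableAt) fun y => by
    rw [(hd y).deriv, show 1 / (1 + y ^ 2) - (1 - y ^ 2 + y ^ 4 - y ^ 6) = y ^ 8 / (1 + y ^ 2) by
      field_simp
      ring]
    positivity
  have := hmono hx
  simp at this
  linarith

theorem sqrt_seventyNine_bounds : 8.88819441 < √79 ∧ √79 < 8.88819442 := by
  constructor
  · rw [Real.lt_sqrt (by norm_num)]
    norm_num
  · rw [Real.sqrt_lt' (by norm_num)]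
    norm_num

theorem sqrt_three_bounds : 1.7320508 < √3 ∧ √3 < 1.7320509 := by
  constructor
  · rw [Real.lt_sqrt (by norm_num)]
    norm_num
  · rw [Real.sqrt_lt' (by norm_num)]
    norm_num

theorem arctan_sqrt_seventyNine_div_eleven_bounds :
    0.6796104 < Real.arctan (√79 / 11) ∧ Real.arctan (√79 / 11) < 0.6796111 := by
  obtain ⟨hl, hu⟩ := sqrt_seventyNine_bounds
  have hsq : √79 ^ 2 = (79 : ℝ) := Real.sq_sqrt (by norm_num)
  -- With `a = √79/11`, the second argument is `(1 - a)/(1 + a)`; it is about 0.106, small enough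
  -- for the short Taylor bounds.
  have hadd : Real.arctan (√79 / 11) + Real.arctan ((100 - 11 * √79) / 21) = Real.pi / 4 := by
    rw [Real.arctan_add (by nlinarith), ← Real.arctan_one]
    congr 1
    rw [div_eq_one_iff_eq (by nlinarith)]
    linear_combination (-1 / 21 : ℝ) * hsq
  have h1 : (0.1061838 : ℝ) < (100 - 11 * √79) / 21 := by linarith
  have h2 : (100 - 11 * √79) / 21 < (0.1061840 : ℝ) := by linarith
  have h3 := Real.arctan_lt_arctan_iff.2 h1
  have h4 := Real.arctan_lt_arctan_iff.2 h2
  have h5 := taylor_le_arctan (x := 0.1061838) (by norm_num)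
  have h6 := arctan_le_taylor (x := 0.1061840) (by norm_num)
  norm_num at h5 h6
  constructor <;> linarith [Real.pi_gt_d20, Real.pi_lt_d20]

theorem discTail_one_at_two : discTail 1 (1 / (18 * 2)) = √3 * Real.pi / 9 := by
  have h := discTail_one (R := 1 / 6) le_rfl (by norm_num)
  rw [div_self (by norm_num), Real.arccos_one, sub_self, Real.sqrt_zero] at h
  rw [show (1 : ℝ) / (18 * 2) = (1 / 6) ^ 2 by norm_num, h]
  ring

theorem discTail_one_at_three_halves :
    discTail 1 (1 / (18 * (3 / 2))) = 4 * √3 * (Real.pi / 54 + √3 / 36) := by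
  have h3 : √3 ^ 2 = (3 : ℝ) := Real.sq_sqrt (by norm_num)
  obtain ⟨hl, hu⟩ := sqrt_three_bounds
  have hsq : (√3 / 9) ^ 2 = (1 / 27 : ℝ) := by linear_combination (1 / 81 : ℝ) * h3
  have h := discTail_one (R := √3 / 9) (by linarith) (by rw [hsq]; norm_num)
  have harc : Real.arccos (1 / 6 / (√3 / 9)) = Real.pi / 6 := by
    rw [show 1 / 6 / (√3 / 9) = √3 / 2 by field_simp; linear_combination (-6 : ℝ) * h3,
      ← Real.cos_pi_div_six, Real.arccos_cos] <;> linarith [Real.pi_pos]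
  have hroot : √(1 / 27 - (1 / 6) ^ 2) = √3 / 18 := by
    rw [show (1 : ℝ) / 27 - (1 / 6) ^ 2 = (√3 / 18) ^ 2 by linear_combination (-1 / 324 : ℝ) * h3,
      Real.sqrt_sq (by positivity)]
  rw [harc, hsq, hroot] at h
  rw [show (1 : ℝ) / (18 * (3 / 2)) = 1 / 27 by norm_num, h]
  ring

theorem discTail_one_at_121_div_100 :
    discTail 1 (1 / (18 * (121 / 100))) = 4 * √3 * (Real.pi * (50 / 1089) -
      3 * (50 / 1089 * Real.arctan (√79 / 11) - √79 / 396)) := by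
  have h2 : √2 ^ 2 = (2 : ℝ) := Real.sq_sqrt (by norm_num)
  have h79 : √79 ^ 2 = (79 : ℝ) := Real.sq_sqrt (by norm_num)
  have hl : (1.4 : ℝ) < √2 := by
    rw [Real.lt_sqrt (by norm_num)]
    norm_num
  have hsq : (5 * √2 / 33) ^ 2 = (50 / 1089 : ℝ) := by linear_combination (25 / 1089 : ℝ) * h2
  have h := discTail_one (R := 5 * √2 / 33) (by linarith) (by rw [hsq]; norm_num)
  have harc : Real.arccos (1 / 6 / (5 * √2 / 33)) = Real.arctan (√79 / 11) := by
    have hc : 1 / 6 / (5 * √2 / 33) = 11 * √2 / 20 := by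
      field_simp
      linear_combination (-330 : ℝ) * h2
    rw [hc, Real.arccos_eq_arctan (by positivity)]
    congr 1
    have : √(1 - (11 * √2 / 20) ^ 2) = √79 * √2 / 20 := by
      rw [show 1 - (11 * √2 / 20) ^ 2 = (√79 * √2 / 20) ^ 2 by
        linear_combination (-1 / 2 : ℝ) * h2 - (√2 ^ 2 / 400) * h79, Real.sqrt_sq (by positivity)]
    rw [this]
    field_simp
  have hroot : √(50 / 1089 - (1 / 6) ^ 2) = √79 / 66 := by
    rw [show (50 : ℝ) / 1089 - (1 / 6) ^ 2 = (√79 / 66) ^ 2 by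
      linear_combination (-1 / 4356 : ℝ) * h79, Real.sqrt_sq (by positivity)]
  rw [harc, hsq, hroot] at h
  rw [show (1 : ℝ) / (18 * (121 / 100)) = 50 / 1089 by norm_num, h]
  ring

/-- Here the radius for shape 1 is the inradius, so all tails are rational multiples of `√3 π` and
only rational inequalities remain. -/
theorem discTail_bounds_at_two :
    discTail 1 (1 / (18 * 2)) < discTail 2 (1 / (18 * ((1.32081 - 5 / 10 ^ 6) ^ 2 * 2))) ∧
    discTail 2 (1 / (18 * ((1.32081 + 5 / 10 ^ 6) ^ 2 * 2))) ≤ discTail 1 (1 / (18 * 2)) := by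
  have hpos : 0 < √3 * Real.pi := by positivity
  rw [discTail_one_at_two, discTail_two (by norm_num) (by norm_num),
    discTail_two (by norm_num) (by norm_num)]
  constructor <;> norm_num <;> nlinarith

theorem discTail_bounds_at_three_halves :
    discTail 1 (1 / (18 * (3 / 2))) <
      discTail 2 (1 / (18 * ((1.31502 - 5 / 10 ^ 6) ^ 2 * (3 / 2)))) ∧
    discTail 2 (1 / (18 * ((1.31502 + 5 / 10 ^ 6) ^ 2 * (3 / 2)))) ≤
      discTail 1 (1 / (18 * (3 / 2))) := by
  obtain ⟨hl, hu⟩ := sqrt_three_bounds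
  have hpi1 := Real.pi_gt_d20
  have hpi2 := Real.pi_lt_d20
  rw [discTail_one_at_three_halves, discTail_two (by norm_num) (by norm_num),
    discTail_two (by norm_num) (by norm_num), show (240 : ℝ) * √3 = 4 * √3 * 60 by ring,
    mul_assoc (4 * √3) 60, mul_assoc (4 * √3) 60]
  refine ⟨mul_lt_mul_of_pos_left ?_ (by positivity), mul_le_mul_of_nonneg_left ?_ (by positivity)⟩
  all_goals norm_num
  all_goals linarith

theorem discTail_bounds_at_121_div_100 :
    discTail 1 (1 / (18 * (121 / 100))) <
      discTail 2 (1 / (18 * ((1.32686 - 5 / 10 ^ 6) ^ 2 * (121 / 100)))) ∧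
    discTail 2 (1 / (18 * ((1.32686 + 5 / 10 ^ 6) ^ 2 * (121 / 100)))) ≤
      discTail 1 (1 / (18 * (121 / 100))) := by
  obtain ⟨hl, hu⟩ := sqrt_seventyNine_bounds
  obtain ⟨hal, hau⟩ := arctan_sqrt_seventyNine_div_eleven_bounds
  have hpi1 := Real.pi_gt_d20
  have hpi2 := Real.pi_lt_d20
  rw [discTail_one_at_121_div_100, discTail_two (by norm_num) (by norm_num),
    discTail_two (by norm_num) (by norm_num), show (240 : ℝ) * √3 = 4 * √3 * 60 by ring,
    mul_assoc (4 * √3) 60, mul_assoc (4 * √3) 60]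
  refine ⟨mul_lt_mul_of_pos_left ?_ (by positivity), mul_le_mul_of_nonneg_left ?_ (by positivity)⟩
  all_goals norm_num
  all_goals linarith

/-! ### Enclosures of the star ratio and conclusion -/

/-- The endpoints are squares because `α̂ = T²`; the same tail inequalities thus serve both
statistics. -/
theorem starRatio_alphaHat_mem_Icc {lam t c ε : ℝ} (hlam : 0 < lam) (ht : 0 < t) (hc : 0 < c - ε)
    (hε : 0 ≤ ε)
    (hb : discTail 1 (1 / (18 * t)) < discTail 2 (1 / (18 * ((c - ε) ^ 2 * t))) ∧
      discTail 2 (1 / (18 * ((c + ε) ^ 2 * t))) ≤ discTail 1 (1 / (18 * t))) :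
    starRatio (gammaSampleLaw 3 alphaHat 1 lam) (gammaSampleLaw 3 alphaHat 2 lam) t ∈
      Set.Icc ((c - ε) ^ 2) ((c + ε) ^ 2) := by
  have hc' : 0 < c + ε := by linarith
  have h := quantile_mem_Icc (ν := gammaSampleLaw 3 alphaHat 2 lam)
    (u := cdf (gammaSampleLaw 3 alphaHat 1 lam) t) (a := (c - ε) ^ 2 * t) (b := (c + ε) ^ 2 * t)
    (by rw [cdf_alphaHat two_pos hlam (by positivity), cdf_alphaHat one_pos hlam ht]; linarith [hb.1])
    (by rw [cdf_alphaHat two_pos hlam (by positivity), cdf_alphaHat one_pos hlam ht]; linarith [hb.2])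
  exact ⟨(le_div_iff₀ ht).2 h.1, (div_le_iff₀ ht).2 h.2⟩

theorem abs_starRatio_meanStdRatio_sub_le {lam x t c ε : ℝ} (hlam : 0 < lam) (hx : 0 < x)
    (hxt : x ^ 2 = t) (hc : 0 < c - ε) (hε : 0 ≤ ε)
    (hb : discTail 1 (1 / (18 * t)) < discTail 2 (1 / (18 * ((c - ε) ^ 2 * t))) ∧
      discTail 2 (1 / (18 * ((c + ε) ^ 2 * t))) ≤ discTail 1 (1 / (18 * t))) :
    |starRatio (gammaSampleLaw 3 meanStdRatio 1 lam) (gammaSampleLaw 3 meanStdRatio 2 lam) x - c| ≤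
      ε := by
  have hc' : 0 < c + ε := by linarith
  subst hxt
  rw [← mul_pow, ← mul_pow] at hb
  have h := quantile_mem_Icc (ν := gammaSampleLaw 3 meanStdRatio 2 lam)
    (u := cdf (gammaSampleLaw 3 meanStdRatio 1 lam) x) (a := (c - ε) * x) (b := (c + ε) * x)
    (by
      rw [cdf_meanStdRatio two_pos hlam (by positivity), cdf_meanStdRatio one_pos hlam hx]
      linarith [hb.1])
    (by
      rw [cdf_meanStdRatio two_pos hlam (by positivity), cdf_meanStdRatio one_pos hlam hx]
      linarith [hb.2])
  have h1 := (le_div_iff₀ hx).2 h.1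
  have h2 := (div_le_iff₀ hx).2 h.2
  rw [starRatio, abs_le]
  constructor <;> linarith

/-- Places the two test points in the range `0 < F < 1` over which the star order is tested. -/
theorem discTail_one_mem_Ioo :
    discTail 1 (1 / (18 * (121 / 100))) ∈ Set.Ioo 0 1 ∧
      discTail 1 (1 / (18 * (3 / 2))) ∈ Set.Ioo 0 1 := by
  obtain ⟨hl, hu⟩ := sqrt_three_bounds
  obtain ⟨hl', hu'⟩ := sqrt_seventyNine_bounds
  obtain ⟨hal, hau⟩ := arctan_sqrt_seventyNine_div_eleven_bounds
  have hpi1 := Real.pi_gt_d6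
  have hpi2 := Real.pi_lt_d6
  rw [discTail_one_at_121_div_100, discTail_one_at_three_halves]
  refine ⟨⟨?_, ?_⟩, ⟨by positivity, ?_⟩⟩
  · refine mul_pos (by positivity) ?_
    linarith
  -- The bound 0.12 suffices since `4√3 · 0.12 < 1`.
  · have h : Real.pi * (50 / 1089) - 3 * (50 / 1089 * Real.arctan (√79 / 11) - √79 / 396) < 0.12 := by
      linarith
    nlinarith
  · have h : Real.pi / 54 + √3 / 36 < 0.12 := by linarith
    nlinarith

theorem corollary3 (lam : ℝ) (hlam : 0 < lam) :
    ¬ IncreasingInParameter StarOrder (fun α => gammaSampleLaw 3 alphaHat α lam) ∧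
    (|starRatio (gammaSampleLaw 3 meanStdRatio 1 lam) (gammaSampleLaw 3 meanStdRatio 2 lam)
        (11 / 10) - 1.32686| ≤ 5 / 10 ^ 6 ∧
     |starRatio (gammaSampleLaw 3 meanStdRatio 1 lam) (gammaSampleLaw 3 meanStdRatio 2 lam)
        (Real.sqrt 6 / 2) - 1.31502| ≤ 5 / 10 ^ 6 ∧
     |starRatio (gammaSampleLaw 3 meanStdRatio 1 lam) (gammaSampleLaw 3 meanStdRatio 2 lam)
        (Real.sqrt 2) - 1.32081| ≤ 5 / 10 ^ 6) := by
  refine ⟨fun hinc => ?_, ?_, ?_, ?_⟩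
  · obtain ⟨⟨h1, h2⟩, ⟨h3, h4⟩⟩ := discTail_one_mem_Ioo
    -- The points are the squares of `11/10` and `√6/2`; monotonicity between them would give
    -- `1.326855² ≤ 1.315025²`.
    have hmono := hinc 1 2 one_pos one_lt_two
      (a := 121 / 100) (b := 3 / 2)
      (by
        simp only [Set.mem_ofPred_eq]
        rw [cdf_alphaHat one_pos hlam (by norm_num)]
        exact ⟨by norm_num, by linarith, by linarith⟩)
      (by
        simp only [Set.mem_ofPred_eq]
        rw [cdf_alphaHat one_pos hlam (by norm_num)]
        exact ⟨by norm_num, by linarith, by linarith⟩)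
      (by norm_num)
    have ha := (starRatio_alphaHat_mem_Icc hlam (by norm_num) (by norm_num) (by norm_num)
      discTail_bounds_at_121_div_100).1
    have hb := (starRatio_alphaHat_mem_Icc hlam (by norm_num) (by norm_num) (by norm_num)
      discTail_bounds_at_three_halves).2
    have h := (ha.trans hmono).trans hb
    norm_num at h
  · exact abs_starRatio_meanStdRatio_sub_le hlam (by norm_num) (by norm_num) (by norm_num)
      (by norm_num) discTail_bounds_at_121_div_100
  · exact abs_starRatio_meanStdRatio_sub_le hlam (by positivity)
      (by rw [div_pow, Real.sq_sqrt (by norm_num)]; norm_num) (by norm_num)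
      (by norm_num) discTail_bounds_at_three_halves
  · exact abs_starRatio_meanStdRatio_sub_le hlam (by positivity)
      (Real.sq_sqrt (by norm_num)) (by norm_num)
      (by norm_num) discTail_bounds_at_two
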